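/- Let $\mathbb{K}$ be an algebraically closed field, let $m,n,r$ be nonnegative integers, and let $L$ be a linear subspace of the space $\mathbb{K}^{m\times n}$ of $m\times n$ matrices. Let $L_r=\{A\in L : \operatorname{rank}A\le r\}$. Then $$\mathrm{SR}(L)\le 2r+\operatorname{codim}_L L_r .$$ Here $\operatorname{codim}_L L_r=\dim L-\dim L_r$, where $\dim L$ is the dimension of the vector space $L$ and $\dim L_r$ is the dimension of the affine variety $L_r\subseteq\mathbb{K}^{m\times n}$, i.e. the maximal length $d$ of a chain $V_0\subsetneq V_1\subsetneq\cdots\subsetneq V_d$ of (nonempty) irreducible varieties contained in $L_r$; this dimension is finite and at most $\dim L$, so that the codimension is a nonnegative integer. The slice rank $\mathrm{SR}(T)$ of a tensor $T=(a_{i,j,k})$, viewed as the trilinear form $\sum_{i,j,k} a_{i,j,k}x_iy_jz_k$, is the least $s$ such that $T=\sum_{t=1}^{s} f_tg_t$, where each $f_t$ is a linear form over $\mathbb{K}$ in one of the three groups of variables $\mathbf{x},\mathbf{y},\mathbf{z}$ and $g_t$ is a bilinear form over $\mathbb{K}$ in the other two groups. The slice rank $\mathrm{SR}(L)$ is the slice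 rank of any tensor $(a_{i,j,k})$ whose slices $A_k=(a_{i,j,k})_{i,j}$ span $L$; it does not depend on the choice of the spanning matrices. -/

import Mathlib

namespace SliceRank

/-! ### Slice rank of tensors and of matrix spaces -/

/-- The tensor `(S i j k)`, viewed as a trilinear form `∑ S i j k * x i * y j * z k`, is the product
of a linear form in one of the three groups of variables and a bilinear form in the other two
groups. (A linear form and a bilinear form are given by their coefficients.) -/
def IsSlice {K ι κ ν : Type*} [Mul K] (S : ι → κ → ν → K) : Prop :=
  (∃ (f : ι → K) (g : κ → ν → K), ∀ i j k, S i j k = f i * g j k) ∨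
  (∃ (f : κ → K) (g : ι → ν → K), ∀ i j k, S i j k = f j * g i k) ∨
  (∃ (f : ν → K) (g : ι → κ → K), ∀ i j k, S i j k = f k * g i j)

/-- `T` is a sum of `r` products as in `IsSlice`. -/
def HasSliceDecomposition {K ι κ ν : Type*} [Semiring K] (T : ι → κ → ν → K) (r : ℕ) : Prop :=
  ∃ S : Fin r → ι → κ → ν → K, (∀ t, IsSlice (S t)) ∧ ∀ i j k, T i j k = ∑ t, S t i j k

/-- The slice rank of a 3-tensor: the least number of summands in a slice decomposition. -/
noncomputable def tensorSliceRank {K ι κ ν : Type*} [Semiring K] (T : ι → κ → ν → K) : ℕ :=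
  sInf {r | HasSliceDecomposition T r}

/-- A slice decomposition exists, so that the infimum above is a minimum. -/
theorem hasSliceDecomposition_tensorSliceRank {K ι κ : Type*} [Semiring K] {a : ℕ}
    (T : ι → κ → Fin a → K) : HasSliceDecomposition T (tensorSliceRank T) := by
  refine Nat.sInf_mem (s := {r | HasSliceDecomposition T r}) ⟨a, ?_⟩
  refine ⟨fun t i j k => (if k = t then 1 else 0) * T i j t, fun t => Or.inr (Or.inr ?_), ?_⟩
  · exact ⟨fun k => if k = t then 1 else 0, fun i j => T i j t, fun _ _ _ => rfl⟩
  · intro i j k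
    simp

/-- The `m × n × a` tensor whose slices are the matrices `A 0, …, A (a - 1)`. -/
def tensorOfMatrices {K : Type*} {m n a : ℕ} (A : Fin a → Matrix (Fin m) (Fin n) K) :
    Fin m → Fin n → Fin a → K :=
  fun i j k => A k i j

/-- The slice rank of a matrix space `L`: the slice rank of a tensor whose slices form a basis
of `L`. By `tensorSliceRank_eq_matrixSpaceSliceRank` any tensor whose slices span `L` gives the
same number. -/
noncomputable def matrixSpaceSliceRank {K : Type*} [Field K] {m n : ℕ}
    (L : Submodule K (Matrix (Fin m) (Fin n) K)) : ℕ :=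
  tensorSliceRank (tensorOfMatrices
    (fun k : Fin (Module.finrank K L) =>
      ((Module.finBasis K L k : L) : Matrix (Fin m) (Fin n) K)))

theorem tensorSliceRank_mono {K : Type*} [Field K] {m n a b : ℕ}
    (A : Fin a → Matrix (Fin m) (Fin n) K) (B : Fin b → Matrix (Fin m) (Fin n) K)
    (h : ∀ k, A k ∈ Submodule.span K (Set.range B)) :
    tensorSliceRank (tensorOfMatrices A) ≤ tensorSliceRank (tensorOfMatrices B) := by
  obtain ⟨S, hS, hB⟩ := hasSliceDecomposition_tensorSliceRank (tensorOfMatrices B)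
  have h' : ∀ k, ∃ c : Fin b → K, ∑ l, c l • B l = A k := fun k =>
    (Submodule.mem_span_range_iff_exists_fun K).1 (h k)
  choose c hc using h'
  refine Nat.sInf_le ⟨fun t i j k => ∑ l, c k l * S t i j l, fun t => ?_, fun i j k => ?_⟩
  · rcases hS t with ⟨f, g, hfg⟩ | ⟨f, g, hfg⟩ | ⟨f, g, hfg⟩
    · refine Or.inl ⟨f, fun j k => ∑ l, c k l * g j l, fun i j k => ?_⟩
      simp only [hfg, Finset.mul_sum]
      exact Finset.sum_congr rfl fun _ _ => by ring
    · refine Or.inr (Or.inl ⟨f, fun i k => ∑ l, c k l * g i l, fun i j k => ?_⟩)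
      simp only [hfg, Finset.mul_sum]
      exact Finset.sum_congr rfl fun _ _ => by ring
    · refine Or.inr (Or.inr ⟨fun k => ∑ l, c k l * f l, g, fun i j k => ?_⟩)
      simp only [hfg, Finset.sum_mul]
      exact Finset.sum_congr rfl fun _ _ => by ring
  · have h1 : tensorOfMatrices A i j k = ∑ l, c k l * tensorOfMatrices B i j l := by
      simp only [tensorOfMatrices, ← hc k, Matrix.sum_apply, Matrix.smul_apply, smul_eq_mul]
    rw [h1, Finset.sum_comm]
    exact Finset.sum_congr rfl fun l _ => by rw [hB, Finset.mul_sum]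

/-- The slice rank of a matrix space does not depend on the choice of spanning matrices. -/
theorem tensorSliceRank_eq_matrixSpaceSliceRank {K : Type*} [Field K] {m n a : ℕ}
    (L : Submodule K (Matrix (Fin m) (Fin n) K)) (A : Fin a → Matrix (Fin m) (Fin n) K)
    (hA : Submodule.span K (Set.range A) = L) :
    tensorSliceRank (tensorOfMatrices A) = matrixSpaceSliceRank L := by
  have hb : Submodule.span K (Set.range (fun k : Fin (Module.finrank K L) =>
      ((Module.finBasis K L k : L) : Matrix (Fin m) (Fin n) K))) = L := by
    have h1 := congrArg (Submodule.map L.subtype) (Module.finBasis K L).span_eq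
    rw [Submodule.map_span, Submodule.map_top, Submodule.range_subtype, ← Set.range_comp] at h1
    exact h1
  apply le_antisymm
  · refine tensorSliceRank_mono _ _ fun k => ?_
    rw [hb, ← hA]
    exact Submodule.subset_span ⟨k, rfl⟩
  · refine tensorSliceRank_mono _ _ fun k => ?_
    rw [hA]
    exact (Module.finBasis K L k).2

/-! ### Affine varieties and their dimension -/

/-- `V ⊆ K^σ` is a variety: the set of common zeros of a finite set of polynomials. -/
def IsVariety {K σ : Type*} [Field K] (V : Set (σ → K)) : Prop :=
  ∃ P : Finset (MvPolynomial σ K), V = {x | ∀ f ∈ P, MvPolynomial.eval x f = 0}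

/-- `V` is an irreducible variety: nonempty and not the union of two strictly smaller varieties. -/
def IsIrreducibleVariety {K σ : Type*} [Field K] (V : Set (σ → K)) : Prop :=
  IsVariety V ∧ V.Nonempty ∧
    ∀ V₁ V₂ : Set (σ → K), IsVariety V₁ → IsVariety V₂ → V = V₁ ∪ V₂ → V = V₁ ∨ V = V₂

/-- The dimension of a variety `X`: the supremum of the lengths `d` of chains
`V₀ ⊂ V₁ ⊂ ⋯ ⊂ V_d` of irreducible varieties contained in `X` (and `⊥` if `X` is empty). -/
noncomputable def varietyDim {K σ : Type*} [Field K] (X : Set (σ → K)) : WithBot ℕ∞ :=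
  Order.krullDim {V : Set (σ → K) // IsIrreducibleVariety V ∧ V ⊆ X}

/-- The variety `L_r` of the matrices of rank at most `r` in the matrix space `L`, as a subset of
the affine space `K^(m × n)` of all `m × n` matrices. -/
def rankSection {K : Type*} [Field K] {m n : ℕ}
    (L : Submodule K (Matrix (Fin m) (Fin n) K)) (r : ℕ) : Set (Fin m × Fin n → K) :=
  {x | Matrix.of (fun i j => x (i, j)) ∈ L ∧ (Matrix.of (fun i j => x (i, j))).rank ≤ r}

/-- The codimension of the variety `X` inside the linear space `L` is the natural number `c`:
`dim X` is finite and `c = dim L - dim X`. -/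
def HasCodimIn {K : Type*} [Field K] {m n : ℕ} (L : Submodule K (Matrix (Fin m) (Fin n) K))
    (X : Set (Fin m × Fin n → K)) (c : ℕ) : Prop :=
  ∃ d : ℕ, varietyDim X = (d : WithBot ℕ∞) ∧ d + c = Module.finrank K L

end SliceRank

-- Let `V` be an irreducible variety in `L_r`, with function field `F` and generic matrix `M` over
-- `F`, whose entries are the coordinate functions. Then `M` has rank at most `r` and is an
-- `F`-combination of a basis of `L`. Derivations of `F` over `K` act as tangent vectors: `D ↦ D(M)`
-- embeds them in `L ⊗ F`, because the entries of `M` generate `F`. If `M = U W` has inner dimension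
-- `rank M`, then `D(M) = U D(W) + D(U) W`, so all matrices `D(M)` together cost slice rank at most
-- `2r`. The rest of `L ⊗ F` costs at most its codimension, `dim L - dim Der`.
--
-- Two facts finish the argument. In every characteristic `dim Der` is at least the transcendence
-- degree of `F` (`trdeg_le_finrank_derivation`), which bounds the length of any chain ending at `V`
-- (`coordTrdeg_lt_coordTrdeg`). A slice decomposition over `F` specializes to one over `K` by the
-- Nullstellensatz (`HasSliceDecomposition.descent`).

universe u

/-! ### Transcendence degree and derivations -/

section

open Module

/-- A transcendence basis of `B` lifts to an independent family `y` in `A`. Were the degrees equal,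
`y` would be a basis, so a nonzero kernel element would divide a nonzero polynomial in `y`; applying
`f` gives a relation in `B`. -/
theorem Algebra.trdeg_lt_trdeg_of_surjective {K : Type*} {A B : Type u} [Field K] [CommRing A]
    [IsDomain A] [CommRing B] [IsDomain B] [Algebra K A] [Algebra K B]
    (hA : Algebra.trdeg K A < Cardinal.aleph0) (f : A →ₐ[K] B) (hf : Function.Surjective f)
    (hf' : ¬ Function.Injective f) : Algebra.trdeg K B < Algebra.trdeg K A := by
  by_contra! hle
  obtain ⟨s, hs⟩ := exists_isTranscendenceBasis K B
  let y : s → A := fun b => Function.surjInv hf b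
  have hy : f ∘ y = (↑) := funext fun b => Function.surjInv_eq hf b
  have hyi : AlgebraicIndependent K y := .of_comp f (hy ▸ hs.1)
  have hyb := hyi.isTranscendenceBasis_of_trdeg_le hA
    (hle.trans hs.cardinalMk_eq_trdeg.ge)
  have := hyb.isAlgebraic
  rw [injective_iff_map_eq_zero] at hf'
  push Not at hf'
  obtain ⟨z, hz, hz0⟩ := hf'
  obtain ⟨⟨c, hc⟩, hc0, w, hw⟩ := (Algebra.IsAlgebraic.isAlgebraic
    (R := Algebra.adjoin K (Set.range y)) z).exists_nonzero_dvd (mem_nonZeroDivisors_of_ne_zero hz0)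
  rw [Algebra.adjoin_range_eq_range_aeval] at hc
  obtain ⟨p, rfl⟩ := hc
  have hw' : MvPolynomial.aeval y p = z * w := hw
  have h0 : MvPolynomial.aeval ((↑) : s → B) p = 0 := by
    have h := congrArg (fun g => g p) (MvPolynomial.comp_aeval y f)
    rw [AlgHom.comp_apply, hw', map_mul, hz, zero_mul] at h
    rw [← hy]
    exact h.symm
  have hp : p = 0 := hs.1 (by simpa using h0)
  exact hc0 (Subtype.ext (by simp [hp]))

/-- If every derivation is determined by its values at the generators `x i`, then the
transcendence degree is bounded by the dimension of the space of derivations. -/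
theorem trdeg_le_finrank_derivation {K F : Type u} {σ : Type*} [Finite σ] [Field K] [Field F]
    [Algebra K F] [Algebra.EssFiniteType K F] (x : σ → F)
    (hx : ∀ D : Derivation K F F, (∀ i, D (x i) = 0) → D = 0) :
    Algebra.trdeg K F ≤ finrank F (Derivation K F F) := by
  classical
  let φ : Derivation K F F →ₗ[F] σ → F :=
    { toFun := fun D i => D (x i)
      map_add' := fun _ _ => rfl
      map_smul' := fun _ _ => rfl }
  have hφ : Function.Injective φ := by
    rw [injective_iff_map_eq_zero]
    exact fun D hD => hx D fun i => congrFun hD i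
  have : Module.Finite F (Derivation K F F) := Module.Finite.of_injective φ hφ
  let ψ : σ → Dual F (Derivation K F F) := fun i => (LinearMap.proj i).comp φ
  -- Choose generators `x (j l)` whose evaluation functionals form a basis of the span of all of
  -- them. A derivation killing the chosen generators kills every `x i`.
  obtain ⟨g, hg, hspan, -⟩ := Submodule.exists_fun_fin_finrank_span_eq F (Set.range ψ)
  choose j hj using hg
  set E := IntermediateField.adjoin K (Set.range (x ∘ j)) with hE
  have hD (D : Derivation E F F) : D = 0 := by
    have h0 : D.restrictScalars K = 0 := by
      refine hx _ fun i => ?_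
      have h1 : ψ i ∈ Submodule.span F (Set.range g) := hspan.ge (Submodule.subset_span ⟨i, rfl⟩)
      have h2 : Submodule.span F (Set.range g) ≤
          LinearMap.ker (Dual.eval F _ (D.restrictScalars K)) := by
        rw [Submodule.span_le]
        rintro _ ⟨l, rfl⟩
        have h3 : D (algebraMap E F ⟨x (j l), IntermediateField.subset_adjoin _ _ ⟨l, rfl⟩⟩) = 0 :=
          D.map_algebraMap _
        rw [← hj]
        exact h3
      exact h2 h1
    ext z
    exact congrArg (fun D' : Derivation K F F => D' z) h0
  have hΩ : Subsingleton (Ω[F⁄E]) := by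
    refine subsingleton_of_forall_eq 0 fun w => ?_
    rw [← Module.forall_dual_apply_eq_zero_iff F]
    intro l
    have := hD (KaehlerDifferential.linearMapEquivDerivation E F l)
    rw [LinearEquiv.map_eq_zero_iff] at this
    rw [this, LinearMap.zero_apply]
  have : Algebra.FormallyUnramified E F := ⟨hΩ⟩
  have : Algebra.EssFiniteType E F := Algebra.EssFiniteType.of_comp K E F
  -- No derivations over `E` means no differentials, so `F` is algebraic over `E`, and the chosen
  -- generators bound the transcendence degree.
  have : Algebra.IsSeparable E F := Algebra.FormallyUnramified.isSeparable E F
  have h1 : Algebra.IsAlgebraic (Algebra.adjoin K (Set.range (x ∘ j))) F :=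
    IntermediateField.isAlgebraic_adjoin_iff_top.1 inferInstance
  refine (Algebra.IsAlgebraic.trdeg_le_cardinalMk K (Set.range (x ∘ j))).trans ?_
  have : Fintype (Set.range (x ∘ j)) := Set.fintypeRange _
  rw [Cardinal.mk_fintype, Nat.cast_le]
  refine (Fintype.card_range_le _).trans ?_
  rw [Fintype.card_fin, ← Subspace.dual_finrank_eq]
  exact Submodule.finrank_le _

end

namespace SliceRank

open Module MvPolynomial

/-! ### Slice decompositions and descent to the base field -/

theorem IsSlice.map {K R ι κ ν : Type*} [Mul K] [Mul R] {S : ι → κ → ν → K} (hS : IsSlice S)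
    (φ : K →ₙ* R) : IsSlice fun i j k => φ (S i j k) := by
  rcases hS with ⟨f, g, h⟩ | ⟨f, g, h⟩ | ⟨f, g, h⟩
  · exact Or.inl ⟨fun i => φ (f i), fun j k => φ (g j k), fun i j k => by simp only [h, map_mul]⟩
  · exact Or.inr (Or.inl ⟨fun i => φ (f i), fun j k => φ (g j k),
      fun i j k => by simp only [h, map_mul]⟩)
  · exact Or.inr (Or.inr ⟨fun i => φ (f i), fun j k => φ (g j k),
      fun i j k => by simp only [h, map_mul]⟩)

theorem HasSliceDecomposition.of_fintype {K ι κ ν τ : Type*} [Semiring K] [Fintype τ]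
    {T : ι → κ → ν → K} (S : τ → ι → κ → ν → K) (hS : ∀ t, IsSlice (S t))
    (hT : ∀ i j k, T i j k = ∑ t, S t i j k) : HasSliceDecomposition T (Fintype.card τ) := by
  refine ⟨fun t => S ((Fintype.equivFin τ).symm t), fun t => hS _, fun i j k => ?_⟩
  rw [hT]
  exact ((Fintype.equivFin τ).symm.sum_comp fun t => S t i j k).symm

/-- A slice over `F` has coefficients in any subalgebra containing a suitable finite set. -/
theorem IsSlice.exists_finite_descent {K F ι κ ν : Type*} [CommRing K] [CommRing F] [Algebra K F]
    [Finite ι] [Finite κ] [Finite ν] {S : ι → κ → ν → F} (hS : IsSlice S) :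
    ∃ s : Set F, s.Finite ∧ ∀ B : Subalgebra K F, s ⊆ B →
      ∃ S' : ι → κ → ν → B, IsSlice S' ∧ ∀ i j k, (S' i j k : F) = S i j k := by
  rcases hS with ⟨f, g, h⟩ | ⟨f, g, h⟩ | ⟨f, g, h⟩ <;>
  refine ⟨Set.range f ∪ Set.range fun p : _ × _ => g p.1 p.2,
      (Set.finite_range _).union (Set.finite_range _), fun B hB => ?_⟩ <;>
  let f' := fun i => (⟨f i, hB (Or.inl ⟨i, rfl⟩)⟩ : B) <;>
  let g' := fun j k => (⟨g j k, hB (Or.inr ⟨(j, k), rfl⟩)⟩ : B)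
  · exact ⟨fun i j k => f' i * g' j k, Or.inl ⟨f', g', fun _ _ _ => rfl⟩,
      fun i j k => (h i j k).symm⟩
  · exact ⟨fun i j k => f' j * g' i k, Or.inr (Or.inl ⟨f', g', fun _ _ _ => rfl⟩),
      fun i j k => (h i j k).symm⟩
  · exact ⟨fun i j k => f' k * g' i j, Or.inr (Or.inr ⟨f', g', fun _ _ _ => rfl⟩),
      fun i j k => (h i j k).symm⟩

theorem _root_.IsAlgClosed.nonempty_algHom_of_finiteType (K B : Type*) [Field K] [IsAlgClosed K]
    [CommRing B] [Nontrivial B] [Algebra K B] [Algebra.FiniteType K B] : Nonempty (B →ₐ[K] K) := by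
  obtain ⟨m, hm⟩ := Ideal.exists_maximal B
  let := Ideal.Quotient.field m
  have := finite_of_finite_type_of_isJacobsonRing K (B ⧸ m)
  have hb : Function.Bijective (Algebra.ofId K (B ⧸ m)) :=
    IsAlgClosed.algebraMap_bijective_of_isIntegral
  exact ⟨((AlgEquiv.ofBijective _ hb).symm : B ⧸ m →ₐ[K] K).comp (Ideal.Quotient.mkₐ K m)⟩

/-- Over an algebraically closed field, the slice rank does not drop under field extensions. -/
theorem HasSliceDecomposition.descent {K F ι κ ν : Type*} [Field K] [IsAlgClosed K] [CommRing F]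
    [Nontrivial F] [Algebra K F] [Finite ι] [Finite κ] [Finite ν] {T : ι → κ → ν → K} {r : ℕ}
    (h : HasSliceDecomposition (fun i j k => algebraMap K F (T i j k)) r) :
    HasSliceDecomposition T r := by
  obtain ⟨S, hS, hT⟩ := h
  choose s hs hS' using fun t => (hS t).exists_finite_descent (K := K)
  -- Only finitely many coefficients occur, so they lie in a finitely generated algebra, which has a
  -- `K`-point.
  let B := Algebra.adjoin K (⋃ t, s t)
  have hB : Algebra.FiniteType K B := (Subalgebra.fg_iff_finiteType _).1
    (Subalgebra.fg_def.2 ⟨_, Set.finite_iUnion hs, rfl⟩)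
  obtain ⟨φ⟩ := IsAlgClosed.nonempty_algHom_of_finiteType K B
  choose S' hS1 hS2 using fun t =>
    hS' t B ((Set.subset_iUnion s t).trans Algebra.subset_adjoin)
  refine ⟨fun t i j k => φ (S' t i j k), fun t => (hS1 t).map (φ : B →ₙ* K), fun i j k => ?_⟩
  have h1 : algebraMap K B (T i j k) = ∑ t, S' t i j k := by
    apply Subtype.ext
    rw [AddSubmonoidClass.coe_finsetSum]
    simp only [hS2]
    exact hT i j k
  rw [← map_sum, ← h1, AlgHom.commutes, Algebra.algebraMap_self, RingHom.id_apply]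

/-! ### From derivations to slices -/

theorem _root_.Matrix.exists_eq_mul_rank {F m n : Type*} [Field F] [Fintype n] [Finite m]
    (M : Matrix m n F) :
    ∃ (U : Matrix m (Fin M.rank) F) (W : Matrix (Fin M.rank) n F), M = U * W := by
  have hu := Submodule.exists_fun_fin_finrank_span_eq F (Set.range M.col)
  rw [← Matrix.rank_eq_finrank_span_cols] at hu
  obtain ⟨u, -, hu, -⟩ := hu
  have h (j : n) : ∃ c : Fin M.rank → F, ∑ t, c t • u t = M.col j :=
    (Submodule.mem_span_range_iff_exists_fun F).1 (hu.ge (Submodule.subset_span ⟨j, rfl⟩))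
  choose c hc using h
  refine ⟨Matrix.of fun i t => u t i, Matrix.of fun t j => c j t, ?_⟩
  ext i j
  have := congrFun (hc j) i
  simp only [Finset.sum_apply, Pi.smul_apply, smul_eq_mul, Matrix.col_apply] at this
  simp [Matrix.mul_apply, ← this, mul_comm]

/-- If a subspace `W` of dimension `e` lies in the span of `a` vectors, then those vectors can be
written modulo `W` through `a - e` vectors. -/
theorem exists_fun_fin_sub_finrank {F E : Type*} [Field F] [AddCommGroup E] [Module F E] {a : ℕ}
    (v : Fin a → E) (W : Submodule F E) (hW : W ≤ Submodule.span F (Set.range v)) :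
    finrank F W ≤ a ∧ ∃ (b : ℕ) (_ : b + finrank F W ≤ a) (C : Fin b → E) (c : Fin a → Fin b → F),
      ∀ k, v k - ∑ l, c k l • C l ∈ W := by
  have := Module.Finite.span_of_finite F (Set.finite_range v)
  have ha : finrank F (Submodule.span F (Set.range v)) ≤ a :=
    (finrank_range_le_card (R := F) v).trans (Fintype.card_fin a).le
  refine ⟨(Submodule.finrank_mono hW).trans ha, ?_⟩
  set L := Submodule.span F (Set.range v)
  obtain ⟨Q, hQ⟩ := Submodule.exists_isCompl (W.submoduleOf L)
  have h1 := Submodule.finrank_add_eq_of_isCompl hQ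
  rw [(Submodule.submoduleOfEquivOfLe hW).finrank_eq] at h1
  have h2 (k : Fin a) : ∃ c : Fin (finrank F Q) → F,
      v k - ∑ l, c l • (finBasis F Q l : E) ∈ W := by
    have hk : (⟨v k, Submodule.subset_span ⟨k, rfl⟩⟩ : L) ∈ W.submoduleOf L ⊔ Q := by
      rw [hQ.sup_eq_top]; trivial
    obtain ⟨w, hw, q, hq, hwq⟩ := Submodule.mem_sup.1 hk
    refine ⟨(finBasis F Q).repr ⟨q, hq⟩, ?_⟩
    have h3 := congrArg (fun z : Q => ((z : L) : E)) ((finBasis F Q).sum_repr ⟨q, hq⟩)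
    have h4 := congrArg (fun z : L => (z : E)) hwq
    simp only [AddSubmonoidClass.coe_finsetSum, Submodule.coe_smul, Submodule.coe_add] at h3 h4
    rw [h3, ← h4, add_sub_cancel_right]
    exact hw
  choose c hc using h2
  exact ⟨_, by omega, _, c, hc⟩

theorem hasSliceDecomposition_of_derivation {K F : Type*} [Field K] [Field F] [Algebra K F]
    {m n a : ℕ} (A : Fin a → Matrix (Fin m) (Fin n) K) (y : Fin a → F)
    (M : Matrix (Fin m) (Fin n) F) (hM : M = ∑ k, y k • (A k).map (algebraMap K F))
    (hD : ∀ D : Derivation K F F, (∀ i j, D (M i j) = 0) → D = 0) :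
    finrank F (Derivation K F F) ≤ a ∧ ∃ b, b + finrank F (Derivation K F F) ≤ a ∧
      HasSliceDecomposition (fun i j k => algebraMap K F (tensorOfMatrices A i j k))
        (2 * M.rank + b) := by
  let Φ : Derivation K F F →ₗ[F] Matrix (Fin m) (Fin n) F :=
    { toFun := fun D => Matrix.of fun i j => D (M i j)
      map_add' := fun _ _ => rfl
      map_smul' := fun _ _ => rfl }
  have hΦ : Function.Injective Φ := by
    rw [injective_iff_map_eq_zero]
    exact fun D h => hD D fun i j => congrFun (congrFun h i) j
  have hW : LinearMap.range Φ ≤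
      Submodule.span F (Set.range fun k => (A k).map (algebraMap K F)) := by
    rintro _ ⟨D, rfl⟩
    have : Φ D = ∑ k, D (y k) • (A k).map (algebraMap K F) := by
      ext i j
      have h1 : Φ D i j = D (M i j) := rfl
      rw [h1, hM]
      simp [Matrix.sum_apply, mul_comm]
    rw [this]
    exact Submodule.sum_mem _ fun k _ => Submodule.smul_mem _ _ (Submodule.subset_span ⟨k, rfl⟩)
  obtain ⟨h1, b, hb, C, c, hc⟩ := exists_fun_fin_sub_finrank _ _ hW
  rw [LinearMap.finrank_range_of_inj hΦ] at h1 hb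
  refine ⟨h1, b, hb, ?_⟩
  -- Thus `A k = (D k)(M) + ∑ l, c k l • C l` over `F`.
  choose D hD' using hc
  obtain ⟨U, W, hUW⟩ := M.exists_eq_mul_rank
  have hcard : Fintype.card ((Fin M.rank ⊕ Fin M.rank) ⊕ Fin b) = 2 * M.rank + b := by
    simp; ring
  rw [← hcard]
  -- The Leibniz rule on `M = U W` gives `rank M` slices in the row variables and as many in the
  -- column variables; the complement gives `b` more.
  refine .of_fintype (Sum.elim (Sum.elim (fun t i j k => U i t * D k (W t j))
    (fun t i j k => W t j * D k (U i t))) (fun l i j k => c k l * C l i j)) ?_ ?_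
  · rintro ((t | t) | l)
    · exact Or.inl ⟨fun i => U i t, fun j k => D k (W t j), fun _ _ _ => rfl⟩
    · exact Or.inr (Or.inl ⟨fun j => W t j, fun i k => D k (U i t), fun _ _ _ => rfl⟩)
    · exact Or.inr (Or.inr ⟨fun k => c k l, fun i j => C l i j, fun _ _ _ => rfl⟩)
  · intro i j k
    have h2 := congrFun (congrFun (hD' k) i) j
    have h3 : Φ (D k) i j = D k (M i j) := rfl
    have h4 : M i j = ∑ t, U i t * W t j := by
      rw [← Matrix.mul_apply, ← hUW]
    rw [h3, h4, Matrix.sub_apply, Matrix.sum_apply, eq_sub_iff_add_eq] at h2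
    simp only [Fintype.sum_sum_type, Sum.elim_inl, Sum.elim_inr]
    have h5 : algebraMap K F (tensorOfMatrices A i j k) = (A k).map (algebraMap K F) i j := rfl
    rw [h5, ← h2]
    simp [Finset.sum_add_distrib]

/-! ### Irreducible varieties and their coordinate rings -/

theorem isVariety_zeroLocus_insert {K σ : Type*} [Field K] {V : Set (σ → K)} (hV : IsVariety V)
    (f : MvPolynomial σ K) : IsVariety {x ∈ V | eval x f = 0} := by
  classical
  obtain ⟨P, rfl⟩ := hV
  exact ⟨insert f P, by ext; simp [and_comm]⟩

theorem isVariety_singleton {K σ : Type*} [Field K] [Fintype σ] (x : σ → K) :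
    IsVariety ({x} : Set (σ → K)) := by
  classical
  refine ⟨Finset.univ.image fun i => X i - C (x i), ?_⟩
  ext z
  simp [funext_iff, sub_eq_zero]

theorem isIrreducibleVariety_singleton {K σ : Type*} [Field K] [Fintype σ] (x : σ → K) :
    IsIrreducibleVariety ({x} : Set (σ → K)) := by
  refine ⟨isVariety_singleton x, Set.singleton_nonempty x, fun V₁ V₂ _ _ h => ?_⟩
  have h1 : V₁ ⊆ {x} := h ▸ Set.subset_union_left
  have h2 : V₂ ⊆ {x} := h ▸ Set.subset_union_right
  have hx : x ∈ V₁ ∪ V₂ := h ▸ rfl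
  exact hx.imp (fun hx => (Set.singleton_subset_iff.2 hx).antisymm h1)
    (fun hx => (Set.singleton_subset_iff.2 hx).antisymm h2)

theorem IsVariety.zeroLocus_vanishingIdeal {K σ : Type*} [Field K] {V : Set (σ → K)}
    (hV : IsVariety V) : zeroLocus K (vanishingIdeal K V) = V := by
  refine Set.Subset.antisymm (fun x hx => ?_) (zeroLocus_vanishingIdeal_le V)
  obtain ⟨P, rfl⟩ := hV
  intro f hf
  simpa [aeval_eq_eval] using hx f fun z hz => by simpa [aeval_eq_eval] using hz f hf

theorem IsIrreducibleVariety.isPrime_vanishingIdeal {K σ : Type*} [Field K] {V : Set (σ → K)}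
    (hV : IsIrreducibleVariety V) : (vanishingIdeal K V).IsPrime := by
  obtain ⟨h1, ⟨x, hx⟩, h2⟩ := hV
  refine ⟨fun h => ?_, fun {f g} hfg => ?_⟩
  · have : (1 : MvPolynomial σ K) ∈ vanishingIdeal K V := h ▸ Submodule.mem_top
    simpa using this x hx
  · have key (p : MvPolynomial σ K) (hp : V = {x ∈ V | eval x p = 0}) :
        p ∈ vanishingIdeal K V := fun z hz => by
      rw [hp] at hz
      exact hz.2
    refine (h2 _ _ (isVariety_zeroLocus_insert h1 f) (isVariety_zeroLocus_insert h1 g) ?_).imp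
      (key f) (key g)
    ext z
    refine ⟨fun hz => ?_, fun hz => hz.elim And.left And.left⟩
    have := hfg z hz
    rw [map_mul, mul_eq_zero] at this
    exact this.imp (fun h => ⟨hz, h⟩) (fun h => ⟨hz, h⟩)

/-- The transcendence degree of the coordinate ring. -/
noncomputable def coordTrdeg {K σ : Type*} [Field K] (V : Set (σ → K)) : ℕ :=
  (Algebra.trdeg K (MvPolynomial σ K ⧸ vanishingIdeal K V)).toNat

theorem coordTrdeg_lt_coordTrdeg {K σ : Type*} [Field K] [Finite σ] {V W : Set (σ → K)}
    (hV : IsIrreducibleVariety V) (hW : IsIrreducibleVariety W) (h : V ⊂ W) :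
    coordTrdeg V < coordTrdeg W := by
  have := hV.isPrime_vanishingIdeal
  have := hW.isPrime_vanishingIdeal
  have hle := vanishingIdeal_anti_mono (k := K) h.le
  have hlt := Algebra.trdeg_lt_trdeg_of_surjective trdeg_lt_aleph0_of_finiteType
    (Ideal.Quotient.factorₐ K hle) (Ideal.Quotient.factor_surjective hle) fun hinj => h.2 ?_
  · exact Cardinal.toNat_lt_toNat hlt trdeg_lt_aleph0_of_finiteType
  · rw [← hV.1.zeroLocus_vanishingIdeal, ← hW.1.zeroLocus_vanishingIdeal]
    refine zeroLocus_anti_mono fun p hp => ?_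
    rw [← Ideal.Quotient.eq_zero_iff_mem] at hp ⊢
    exact hinj (by simpa using hp)

/-! ### Minors and the generic matrix -/

theorem _root_.Matrix.exists_submatrix_det_ne_zero {F m n : Type*} [Field F] [Fintype n]
    [Fintype m] (M : Matrix m n F) :
    ∃ (f : Fin M.rank → m) (g : Fin M.rank → n), (M.submatrix f g).det ≠ 0 := by
  have hu := Submodule.exists_fun_fin_finrank_span_eq F (Set.range M.col)
  rw [← Matrix.rank_eq_finrank_span_cols] at hu
  obtain ⟨u, hu, -, hli⟩ := hu
  choose g hg using hu
  have hli' : LinearIndependent F (M.submatrix id g).col := by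
    rwa [show (M.submatrix id g).col = u from funext hg]
  have hr : (M.submatrix id g).rank = M.rank := by
    rw [← Matrix.rank_transpose]
    simpa using LinearIndependent.rank_matrix (M := (M.submatrix id g).transpose) hli'
  have hw := Submodule.exists_fun_fin_finrank_span_eq F (Set.range (M.submatrix id g).row)
  rw [← Matrix.rank_eq_finrank_span_row, hr] at hw
  obtain ⟨w, hw, -, hli2⟩ := hw
  choose f hf using hw
  refine ⟨f, g, ?_⟩
  rw [show M.submatrix f g = (M.submatrix id g).submatrix f id from rfl,
    ← isUnit_iff_ne_zero, ← Matrix.isUnit_iff_isUnit_det,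
    ← Matrix.linearIndependent_rows_iff_isUnit]
  rwa [show ((M.submatrix id g).submatrix f id).row = w from funext hf]

section

variable {K : Type u} [Field K] {m n : ℕ} {V : Set (Fin m × Fin n → K)} (F : Type u) [Field F]
  [Algebra K F] [Algebra (MvPolynomial (Fin m × Fin n) K ⧸ vanishingIdeal K V) F]
  [IsScalarTower K (MvPolynomial (Fin m × Fin n) K ⧸ vanishingIdeal K V) F]

/-- The generic matrix of `V`, over the field of fractions of the coordinate ring. -/
noncomputable def genericMatrix (V : Set (Fin m × Fin n → K)) (F : Type u) [Field F]
    [Algebra (MvPolynomial (Fin m × Fin n) K ⧸ vanishingIdeal K V) F] : Matrix (Fin m) (Fin n) F :=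
  Matrix.of fun i j => algebraMap (MvPolynomial (Fin m × Fin n) K ⧸ vanishingIdeal K V) F
    (Ideal.Quotient.mk _ (X (i, j)))

theorem aeval_genericMatrix (p : MvPolynomial (Fin m × Fin n) K) :
    aeval (fun ij : Fin m × Fin n => genericMatrix V F ij.1 ij.2) p =
      algebraMap (MvPolynomial (Fin m × Fin n) K ⧸ vanishingIdeal K V) F
        (Ideal.Quotient.mk _ p) := by
  have : aeval (fun ij : Fin m × Fin n => genericMatrix V F ij.1 ij.2) =
      (IsScalarTower.toAlgHom K (MvPolynomial (Fin m × Fin n) K ⧸ vanishingIdeal K V)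
        F).comp (Ideal.Quotient.mkₐ K _) := by
    ext ij
    simp [genericMatrix]
  rw [this]
  rfl

variable [IsFractionRing (MvPolynomial (Fin m × Fin n) K ⧸ vanishingIdeal K V) F]

theorem aeval_genericMatrix_eq_zero_iff (p : MvPolynomial (Fin m × Fin n) K) :
    aeval (fun ij : Fin m × Fin n => genericMatrix V F ij.1 ij.2) p = 0 ↔
      ∀ x ∈ V, eval x p = 0 := by
  rw [aeval_genericMatrix F, IsFractionRing.to_map_eq_zero_iff, Ideal.Quotient.eq_zero_iff_mem]
  rfl

/-- A nonzero minor of maximal size is a polynomial not vanishing identically on `V`, so it is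
nonzero at some point of `V`. -/
theorem rank_genericMatrix_le {r : ℕ}
    (h : ∀ x ∈ V, (Matrix.of fun i j => x (i, j)).rank ≤ r) : (genericMatrix V F).rank ≤ r := by
  obtain ⟨f, g, hfg⟩ := (genericMatrix V F).exists_submatrix_det_ne_zero
  let P : Matrix (Fin m) (Fin n) (MvPolynomial (Fin m × Fin n) K) := Matrix.of fun i j => X (i, j)
  have h1 : aeval (fun ij : Fin m × Fin n => genericMatrix V F ij.1 ij.2)
      (P.submatrix f g).det ≠ 0 := by
    rw [AlgHom.map_det]
    rwa [show (aeval fun ij : Fin m × Fin n => genericMatrix V F ij.1 ij.2).mapMatrix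
      (P.submatrix f g) = (genericMatrix V F).submatrix f g by ext i j; simp [P]]
  rw [Ne, aeval_genericMatrix_eq_zero_iff F] at h1
  push Not at h1
  obtain ⟨x, hx, hx0⟩ := h1
  rw [RingHom.map_det] at hx0
  have h2 : ((Matrix.of fun i j => x (i, j)).submatrix f g).det ≠ 0 := by
    convert hx0
    ext i j
    simp [P]
  have h3 := Matrix.rank_of_det_ne_zero h2
  rw [Fintype.card_fin] at h3
  rw [← h3]
  exact (Matrix.rank_submatrix_le _ _ _).trans (h x hx)

theorem exists_genericMatrix_eq_sum {a : ℕ}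
    (L : Submodule K (Matrix (Fin m) (Fin n) K)) (b : Basis (Fin a) K L)
    (h : ∀ x ∈ V, (Matrix.of fun i j => x (i, j)) ∈ L) :
    ∃ y : Fin a → F, genericMatrix V F =
      ∑ k, y k • (b k : Matrix (Fin m) (Fin n) K).map (algebraMap K _) := by
  obtain ⟨π, hπ⟩ := L.subtype.exists_leftInverse_of_injective L.ker_subtype
  -- Coordinates on `L`, extended to all matrices through a linear retraction `π`, become linear
  -- polynomials.
  let q (k : Fin a) : MvPolynomial (Fin m × Fin n) K :=
    ∑ ij : Fin m × Fin n, C (b.repr (π (Matrix.single ij.1 ij.2 1)) k) * X ij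
  have hq (x : Fin m × Fin n → K) (k : Fin a) :
      eval x (q k) = b.repr (π (Matrix.of fun i j => x (i, j))) k := by
    have h1 : (Matrix.of fun i j => x (i, j)) =
        ∑ ij : Fin m × Fin n, x ij • Matrix.single ij.1 ij.2 (1 : K) := by
      rw [Matrix.matrix_eq_sum_single (Matrix.of fun i j => x (i, j)), Fintype.sum_prod_type]
      simp [Matrix.smul_single]
    rw [h1]
    simp only [q, map_sum, map_mul, map_smul, eval_C, eval_X, Finsupp.coe_finsetSum,
      Finset.sum_apply, Finsupp.smul_apply, smul_eq_mul, mul_comm]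
  refine ⟨fun k => aeval (fun ij : Fin m × Fin n => genericMatrix V F ij.1 ij.2) (q k), ?_⟩
  ext i j
  have h2 := (aeval_genericMatrix_eq_zero_iff F (V := V) (X (i, j) -
    ∑ k, q k * C ((b k : Matrix (Fin m) (Fin n) K) i j))).2 fun x hx => by
      have h3 := congrArg (fun z : L => (z : Matrix (Fin m) (Fin n) K) i j)
        (b.sum_repr ⟨_, h x hx⟩)
      have h4 : π (Matrix.of fun i j => x (i, j)) = ⟨_, h x hx⟩ :=
        LinearMap.congr_fun hπ ⟨_, h x hx⟩
      simp only [AddSubmonoidClass.coe_finsetSum, Submodule.coe_smul, Matrix.sum_apply,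
        Matrix.smul_apply, smul_eq_mul, Matrix.of_apply] at h3
      simp only [map_sub, eval_X, map_sum, map_mul, eval_C, hq, h4, h3, sub_self]
  rw [map_sub, sub_eq_zero, aeval_X] at h2
  rw [h2]
  simp [Matrix.sum_apply]

theorem derivation_eq_zero_of_genericMatrix (D : Derivation K F F)
    (hD : ∀ i j, D (genericMatrix V F i j) = 0) : D = 0 := by
  have h1 (z : MvPolynomial (Fin m × Fin n) K ⧸ vanishingIdeal K V) :
      D (algebraMap _ _ z) = 0 := by
    obtain ⟨p, rfl⟩ := Ideal.Quotient.mk_surjective z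
    rw [← aeval_genericMatrix F]
    induction p using MvPolynomial.induction_on with
    | C c => simp
    | add p q hp hq => rw [map_add, map_add, hp, hq, add_zero]
    | mul_X p ij hp => rw [map_mul, D.leibniz, hp, aeval_X, hD, smul_zero, smul_zero, add_zero]
  ext z
  obtain ⟨u, v, hv, rfl⟩ := IsFractionRing.div_surjective
    (A := MvPolynomial (Fin m × Fin n) K ⧸ vanishingIdeal K V) z
  simp [Derivation.leibniz_div, h1]

theorem coordTrdeg_le_finrank_derivation :
    coordTrdeg V ≤ finrank F (Derivation K F F) := by
  have := Algebra.EssFiniteType.of_isLocalization F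
    (nonZeroDivisors (MvPolynomial (Fin m × Fin n) K ⧸ vanishingIdeal K V))
  have := Algebra.EssFiniteType.comp K (MvPolynomial (Fin m × Fin n) K ⧸ vanishingIdeal K V) F
  have h1 := trdeg_le_finrank_derivation (K := K)
    (fun ij : Fin m × Fin n => genericMatrix V F ij.1 ij.2)
    fun D hD => derivation_eq_zero_of_genericMatrix F D fun i j => hD (i, j)
  have h2 := trdeg_le_of_injective
    (IsScalarTower.toAlgHom K (MvPolynomial (Fin m × Fin n) K ⧸ vanishingIdeal K V) F)
    (IsFractionRing.injective _ _)
  have h3 := Cardinal.toNat_le_toNat (h2.trans h1) (Cardinal.natCast_lt_aleph0)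
  rwa [Cardinal.toNat_natCast] at h3

end

/-! ### Conclusion -/

theorem coordTrdeg_le_and_matrixSpaceSliceRank_le {K : Type*} [Field K] [IsAlgClosed K]
    {m n : ℕ} {V : Set (Fin m × Fin n → K)}
    (L : Submodule K (Matrix (Fin m) (Fin n) K)) (r : ℕ)
    (hV : IsIrreducibleVariety V) (hVL : V ⊆ rankSection L r) :
    coordTrdeg V ≤ finrank K L ∧
      matrixSpaceSliceRank L ≤ 2 * r + (finrank K L - coordTrdeg V) := by
  have := hV.isPrime_vanishingIdeal
  let F := FractionRing (MvPolynomial (Fin m × Fin n) K ⧸ vanishingIdeal K V)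
  obtain ⟨y, hy⟩ := exists_genericMatrix_eq_sum F L (finBasis K L) fun x hx => (hVL hx).1
  obtain ⟨h1, b, hb, hS⟩ := hasSliceDecomposition_of_derivation _ y _ hy
    (derivation_eq_zero_of_genericMatrix F)
  have h2 := rank_genericMatrix_le F fun x hx => (hVL hx).2
  have h3 := coordTrdeg_le_finrank_derivation F (V := V)
  refine ⟨h3.trans h1, (Nat.sInf_le hS.descent).trans ?_⟩
  omega

end SliceRank

theorem proposition3p3 {K : Type*} [Field K] [IsAlgClosed K] (m n : ℕ)
    (L : Submodule K (Matrix (Fin m) (Fin n) K)) (r : ℕ) :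
    ∃ c : ℕ, SliceRank.HasCodimIn L (SliceRank.rankSection L r) c ∧
      SliceRank.matrixSpaceSliceRank L ≤ 2 * r + c := by
  let 𝒱 := {V : Set (Fin m × Fin n → K) //
    SliceRank.IsIrreducibleVariety V ∧ V ⊆ SliceRank.rankSection L r}
  have h0 : (0 : Fin m × Fin n → K) ∈ SliceRank.rankSection L r := by
    have : (Matrix.of fun i j => (0 : Fin m × Fin n → K) (i, j)) = 0 := rfl
    constructor
    · rw [this]; exact L.zero_mem
    · rw [this, Matrix.rank_zero]; exact Nat.zero_le r
  have hne : Nonempty 𝒱 :=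
    ⟨⟨{0}, SliceRank.isIrreducibleVariety_singleton 0, Set.singleton_subset_iff.2 h0⟩⟩
  have hmono : StrictMono fun V : 𝒱 => SliceRank.coordTrdeg V.1 := fun V W h =>
    SliceRank.coordTrdeg_lt_coordTrdeg V.2.1 W.2.1 h
  have hlen (p : LTSeries 𝒱) : p.length ≤ SliceRank.coordTrdeg p.last.1 := by
    have := (p.map _ hmono).head_add_length_le_nat
    rw [LTSeries.last_map] at this
    exact (Nat.le_add_left _ _).trans this
  have hmain (p : LTSeries 𝒱) := SliceRank.coordTrdeg_le_and_matrixSpaceSliceRank_le L r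
    p.last.2.1 p.last.2.2
  have hle : Order.krullDim 𝒱 ≤ (Module.finrank K L : ℕ) :=
    iSup_le fun p => Nat.cast_le.2 ((hlen p).trans (hmain p).1)
  -- The point `0` excludes `⊥`; the bound by `dim L` excludes `⊤`.
  obtain ⟨d, hd⟩ : ∃ d : ℕ, Order.krullDim 𝒱 = d := by
    have h1 := Order.krullDim_nonneg (α := 𝒱)
    generalize Order.krullDim 𝒱 = k at h1 hle
    induction k with
    | bot => simp at h1
    | coe k =>
      induction k with
      | top => exact absurd (WithBot.coe_le_coe.1 hle) (by simp)
      | coe k => exact ⟨k, rfl⟩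
  -- Apply the bound to the top of a chain of maximal length. That its transcendence degree is at
  -- least the length suffices; equality is not needed.
  obtain ⟨p, rfl⟩ := Order.le_krullDim_iff.1 hd.ge
  have h1 := hlen p
  have h2 := hmain p
  exact ⟨Module.finrank K L - p.length, ⟨p.length, hd, by omega⟩, by omega⟩
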